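/- For a finite simple graph $G$ and an integer $p>1$ let $e_p(G)=\sum_{v\in V(G)} d_G(v)^p$, where $d_G(v)$ is the degree of $v$. Let $\mathcal{C}^*$ be the family of all cycles of even length ($C_4, C_6, C_8,\dots$), and let $ex_p(n,\mathcal{C}^*)$ be the maximum of $e_p(G)$ over all graphs $G$ on $n$ vertices that contain no member of $\mathcal{C}^*$ as a (not necessarily induced) subgraph. Let $F_n$ be the friendship graph on $n$ vertices, that is, the graph obtained from the star on $n$ vertices by adding a maximum matching on the set of its leaves. Then for all integers $n\ge 4$ and $p>1$, $$ex_p(n,\mathcal{C}^*)=e_p(F_n),$$ and $F_n$ is the unique extremal graph: a graph $G$ on $n$ vertices contains no even cycle and satisfies $e_p(G)=ex_p(n,\mathcal{C}^*)$ if and only if $G\cong F_n$. -/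

import Mathlib

/-- The degree power `e_p(G) = ∑ v, d_G(v) ^ p` of a finite simple graph. -/
def degreePower {V : Type*} [Fintype V] (p : ℕ) (G : SimpleGraph V) [DecidableRel G.Adj] : ℕ :=
  ∑ v : V, G.degree v ^ p

/-- `G` is free of the family `𝓗` of finite graphs: it contains no member of `𝓗` as a (not
necessarily induced) subgraph. -/
def FamilyFree {V : Type*} (𝓗 : Set (Σ m : ℕ, SimpleGraph (Fin m))) (G : SimpleGraph V) : Prop :=
  ∀ H ∈ 𝓗, H.2.Free G

open scoped Classical in
/-- `ex_p(n, 𝓗)`: the maximum of `e_p(G)` over all graphs `G` on `n` vertices that are free of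
the family `𝓗` (it is `0` if there is no such graph). -/
noncomputable def exDegreePower (p n : ℕ) (𝓗 : Set (Σ m : ℕ, SimpleGraph (Fin m))) : ℕ :=
  Finset.sup (Finset.univ.filter fun G : SimpleGraph (Fin n) => FamilyFree 𝓗 G)
    (fun G => degreePower p G)

/-- The family of the even cycles `C_4, C_6, C_8, …`. -/
def evenCycles : Set (Σ m : ℕ, SimpleGraph (Fin m)) :=
  {H | ∃ k : ℕ, 2 ≤ k ∧ H = ⟨2 * k, SimpleGraph.cycleGraph (2 * k)⟩}

/-- The star `S_n` on `n` vertices, with centre `0` and leaves `1, …, n - 1`. -/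
def starOn (n : ℕ) : SimpleGraph (Fin n) where
  Adj i j := i ≠ j ∧ (i.val = 0 ∨ j.val = 0)
  symm := ⟨fun _ _ h => ⟨h.1.symm, h.2.symm⟩⟩
  loopless := ⟨fun _ h => h.1 rfl⟩

/-- The maximum matching `{1, 2}, {3, 4}, {5, 6}, …` on the leaves `1, …, n - 1` of the star; the
leaf `n - 1` is unmatched if `n` is even. -/
def leafMatching (n : ℕ) : SimpleGraph (Fin n) where
  Adj i j := i ≠ j ∧ i.val ≠ 0 ∧ j.val ≠ 0 ∧ (i.val + 1) / 2 = (j.val + 1) / 2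
  symm := ⟨fun _ _ h => ⟨h.1.symm, h.2.2.1, h.2.1, h.2.2.2.symm⟩⟩
  loopless := ⟨fun _ h => h.1 rfl⟩

instance (n : ℕ) : DecidableRel (starOn n).Adj := fun i j =>
  inferInstanceAs (Decidable (i ≠ j ∧ (i.val = 0 ∨ j.val = 0)))

instance (n : ℕ) : DecidableRel (leafMatching n).Adj := fun i j =>
  inferInstanceAs (Decidable
    (i ≠ j ∧ i.val ≠ 0 ∧ j.val ≠ 0 ∧ (i.val + 1) / 2 = (j.val + 1) / 2))

/-- The friendship graph `F_n` on `n` vertices: the star `S_n` together with a maximum matching on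
the set of its leaves. -/
def friendshipGraph (n : ℕ) : SimpleGraph (Fin n) := starOn n ⊔ leafMatching n

instance (n : ℕ) : DecidableRel (friendshipGraph n).Adj :=
  inferInstanceAs (DecidableRel (starOn n ⊔ leafMatching n).Adj)

/-!
Among the graphs on `n = N + 1` vertices without even cycles, the friendship graph maximizes the
degree power, by induction along cut vertices.

In an even-cycle-free graph, a path that avoids `v` and joins two distinct neighbours of `v` has odd
length, since it closes up through `v`. If three neighbours of `v` were connected in `G - v`, a
tripod joining them to a vertex `q` would consist of three paths whose lengths have pairwise odd
sums, which is impossible (`not_reachable_of_three_neighbors`). So every vertex of degree at least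
three is a cut vertex: the graph is glued at `v` from two smaller graphs (`exists_separation`).

If the parts have `B + 1` and `C + 1` vertices and `v` has degrees `b ≤ B` and `c ≤ C` in them, gluing
raises the degree power by `(b + c)^p - b^p - c^p`, which by convexity is at most
`(B + C)^p - B^p - C^p`; the values `friendshipValue` absorb exactly this gain
(`friendshipValue_glue`). If no vertex has degree three or more, the degree power is at most
`n * 2^p`, which is too small for `n ≥ 4`. This gives the bound, and strict convexity shows that
equality forces a vertex adjacent to all others (`degreePowerIn_le`).

Away from a universal vertex, the absence of `C_4` leaves a matching, so the graph is a windmill, whose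
degree power is `N^p + (N - s) + s * 2^p` with `s` the number of matched leaves; it is extremal only
for a maximum matching (`IsWindmill.degreePower_eq_iff`). Two windmills of the same order with the
same number of matched leaves are isomorphic, because involutions with equally large supports are
conjugate (`IsWindmill.nonempty_iso`).
-/

open SimpleGraph

/-! ### Paths around a vertex of an even-cycle-free graph -/

section Tripod

variable {V : Type*} {G H : SimpleGraph V}

theorem not_even_length_of_isCycle (hG : FamilyFree evenCycles G) {v : V} {c : G.Walk v v}
    (hc : c.IsCycle) : ¬ Even c.length := by
  rintro ⟨k, hk⟩
  have h3 := hc.three_le_length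
  refine hG ⟨2 * k, cycleGraph (2 * k)⟩ ⟨k, by omega, rfl⟩ ?_
  exact (cycleGraph_isContained_iff (by omega)).2 ⟨v, c, hc, by omega⟩

theorem notMem_support_of_isolated {v a b : V} (hv : ∀ x, ¬ H.Adj v x) (hva : v ≠ a)
    (P : H.Walk a b) : v ∉ P.support := by
  classical
  intro h
  cases (P.takeUntil v h).reverse with
  | nil => exact hva rfl
  | cons h _ => exact hv _ h

/-- Closing the path up through `v` gives a cycle with two more edges, and that cycle is odd. -/
theorem odd_length_of_isPath (hG : FamilyFree evenCycles G) (hHG : H ≤ G) {v a b : V}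
    (hv : ∀ x, ¬ H.Adj v x) (ha : G.Adj v a) (hb : G.Adj v b) (hab : a ≠ b)
    {P : H.Walk a b} (hP : P.IsPath) : Odd P.length := by
  have hs : v ∉ (P.mapLe hHG).support := by
    simpa using notMem_support_of_isolated hv ha.ne P
  have hc : (Walk.cons ha ((P.mapLe hHG).concat hb.symm)).IsCycle := by
    rw [Walk.cons_isCycle_iff]
    refine ⟨(Walk.IsPath.mapLe hHG hP).concat hs _, ?_⟩
    rw [Walk.edges_concat, List.concat_eq_append, List.mem_append, not_or]
    refine ⟨fun h => hs (Walk.fst_mem_support_of_mem_edges _ h), ?_⟩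
    simp [hab, hb.ne]
  have := not_even_length_of_isCycle hG hc
  simp only [Walk.length_cons, Walk.length_concat, Walk.length_map, Walk.mapLe] at this
  grind

theorem exists_isPath_first_hit {S : Set V} {c x : V} (Q : H.Walk c x) (hx : x ∈ S) :
    ∃ q ∈ S, ∃ R : H.Walk c q, R.IsPath ∧ ∀ y ∈ R.support, y ∈ S → y = q := by
  classical
  induction Q with
  | nil => exact ⟨_, hx, .nil, .nil, by simp⟩
  | @cons c d x h Q ih =>
    by_cases hc : c ∈ S
    · exact ⟨c, hc, .nil, .nil, by simp⟩
    obtain ⟨q, hq, R, -, hR⟩ := ih hx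
    refine ⟨q, hq, (Walk.cons h R).bypass, Walk.bypass_isPath _, fun y hy hyS => ?_⟩
    have := Walk.support_bypass_subset_support _ hy
    rw [Walk.support_cons, List.mem_cons] at this
    rcases this with rfl | h'
    · exact absurd hyS hc
    · exact hR y h' hyS

theorem isPath_append_reverse {a b q : V} {P : H.Walk a q} {R : H.Walk b q} (hP : P.IsPath)
    (hR : R.IsPath) (h : ∀ y ∈ R.support, y ∈ P.support → y = q) :
    (P.append R.reverse).IsPath := by
  rw [Walk.isPath_def, Walk.support_append, List.nodup_append]
  refine ⟨hP.support_nodup, hR.reverse.support_nodup.tail, ?_⟩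
  rintro x hx y hy rfl
  have hyq := h x (by simpa using List.mem_of_mem_tail hy) hx
  subst hyq
  have := hR.reverse.support_nodup
  rw [← Walk.cons_tail_support, List.nodup_cons] at this
  exact this.1 hy

/-- Three neighbours of `v` do not lie in one component of `G - v`: otherwise three internally
disjoint paths would lead from them to a common vertex `q`, any two of which have lengths with an
odd sum. -/
theorem not_reachable_of_three_neighbors (hG : FamilyFree evenCycles G) (hHG : H ≤ G)
    {v a b c : V} (hv : ∀ x, ¬ H.Adj v x) (ha : G.Adj v a) (hb : G.Adj v b) (hc : G.Adj v c)
    (hab : a ≠ b) (hac : a ≠ c) (hbc : b ≠ c) (rab : H.Reachable a b) :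
    ¬ H.Reachable a c := by
  classical
  intro rac
  obtain ⟨P, hP⟩ := rab.exists_isPath
  obtain ⟨Q⟩ := rac.symm
  obtain ⟨q, hq, R, hR, hRP⟩ :=
    exists_isPath_first_hit (S := {y | y ∈ P.support}) Q P.start_mem_support
  have hq : q ∈ P.support := hq
  have h1 := odd_length_of_isPath hG hHG hv ha hb hab hP
  have h2 := odd_length_of_isPath hG hHG hv ha hc hac
    (isPath_append_reverse (hP.takeUntil hq) hR
      fun y hy hy' => hRP y hy (P.support_takeUntil_subset_support hq hy'))
  have h3 := odd_length_of_isPath hG hHG hv hb hc hbc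
    (isPath_append_reverse (hP.dropUntil hq).reverse hR
      fun y hy hy' => hRP y hy (P.support_dropUntil_subset_support hq (by simpa using hy')))
  have h4 := congrArg Walk.length (P.take_spec hq)
  simp only [Walk.length_append, Walk.length_reverse] at h2 h3 h4
  grind

end Tripod

/-! ### Separation at a vertex of degree at least three -/

section Separation

variable {V : Type*} {G : SimpleGraph V}

open scoped Classical in
/-- The degree of `x` in the subgraph of `G` induced on `A ∪ {x}`. -/
noncomputable def degIn (G : SimpleGraph V) (A : Finset V) (x : V) : ℕ :=
  (A.filter (G.Adj x)).card

/-- The degree power `e_p` of the subgraph of `G` induced on `A`. Working with finsets of one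
fixed vertex type keeps the induction below free of subtypes. -/
noncomputable def degreePowerIn (p : ℕ) (G : SimpleGraph V) (A : Finset V) : ℕ :=
  ∑ x ∈ A, degIn G A x ^ p

theorem degIn_le {A : Finset V} {x : V} (hx : x ∈ A) : degIn G A x ≤ A.card - 1 := by
  classical
  rw [← Finset.card_erase_of_mem hx]
  refine Finset.card_le_card fun y hy => ?_
  rw [Finset.mem_filter] at hy
  exact Finset.mem_erase.2 ⟨hy.2.ne', hy.1⟩

theorem exists_separation [DecidableEq V] (hG : FamilyFree evenCycles G) {A : Finset V} {v : V}
    (hvA : v ∈ A) (h3 : 3 ≤ degIn G A v) :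
    ∃ B C : Finset V, B ∪ C = A ∧ B ∩ C = {v} ∧ 2 ≤ B.card ∧ 2 ≤ C.card ∧
      ∀ x ∈ B, x ≠ v → ∀ y ∈ C, y ≠ v → ¬ G.Adj x y := by
  classical
  obtain ⟨a, b, c, ha, hb, hc, hab, hac, hbc⟩ := Finset.two_lt_card_iff.1 h3
  rw [Finset.mem_filter] at ha hb hc
  let H : SimpleGraph V :=
    { Adj := fun x y => G.Adj x y ∧ x ∈ A.erase v ∧ y ∈ A.erase v
      symm := ⟨fun x y h => ⟨h.1.symm, h.2.2, h.2.1⟩⟩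
      loopless := ⟨fun x h => G.loopless.irrefl x h.1⟩ }
  have hHG : H ≤ G := fun x y h => h.1
  have hv : ∀ x, ¬ H.Adj v x := fun x h => Finset.notMem_erase v A h.2.1
  obtain ⟨x, y, hx, hy, hxy⟩ : ∃ x y, (x ∈ A ∧ G.Adj v x) ∧ (y ∈ A ∧ G.Adj v y) ∧
      ¬ H.Reachable x y := by
    by_cases rab : H.Reachable a b
    · exact ⟨a, c, ha, hc, not_reachable_of_three_neighbors hG hHG hv ha.2 hb.2 hc.2 hab hac hbc
        rab⟩
    · exact ⟨a, b, ha, hb, rab⟩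
  refine ⟨insert v ((A.erase v).filter (H.Reachable x)),
    insert v ((A.erase v).filter fun z => ¬ H.Reachable x z), ?_, ?_, ?_, ?_, ?_⟩
  · ext z; simp only [Finset.mem_union, Finset.mem_insert, Finset.mem_filter, Finset.mem_erase]
    by_cases hz : z = v
    · simp [hz, hvA]
    · simp only [hz]; tauto
  · ext z; simp only [Finset.mem_inter, Finset.mem_insert, Finset.mem_filter, Finset.mem_singleton]
    tauto
  · exact Finset.one_lt_card.2 ⟨v, by simp, x, by simp [hx.1, hx.2.ne'], hx.2.ne⟩
  · exact Finset.one_lt_card.2 ⟨v, by simp, y, by simp [hy.1, hy.2.ne', hxy], hy.2.ne⟩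
  · intro z hz hzv w hw hwv hzw
    simp only [Finset.mem_insert, Finset.mem_filter, hzv, hwv, false_or] at hz hw
    exact hw.2 (hz.2.trans (Adj.reachable (G := H) ⟨hzw, hz.1, hw.1⟩))

theorem degreePowerIn_union [DecidableEq V] (p : ℕ) {B C : Finset V} {v : V}
    (hBC : B ∩ C = {v}) (hadj : ∀ x ∈ B, x ≠ v → ∀ y ∈ C, y ≠ v → ¬ G.Adj x y) :
    degIn G (B ∪ C) v = degIn G B v + degIn G C v ∧
      degreePowerIn p G (B ∪ C) + (degIn G B v ^ p + degIn G C v ^ p) =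
        degreePowerIn p G B + degreePowerIn p G C + (degIn G B v + degIn G C v) ^ p := by
  classical
  have hmem : ∀ x, x ∈ B → x ∈ C → x = v := fun x hB hC => by
    have : x ∈ B ∩ C := Finset.mem_inter.2 ⟨hB, hC⟩
    simpa [hBC] using this
  have hv : v ∈ B ∩ C := by simp [hBC]
  obtain ⟨hvB, hvC⟩ := Finset.mem_inter.1 hv
  have hd : degIn G (B ∪ C) v = degIn G B v + degIn G C v := by
    unfold degIn
    rw [Finset.filter_union, Finset.card_union_of_disjoint]
    rw [Finset.disjoint_left]
    intro x hx hx'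
    rw [Finset.mem_filter] at hx hx'
    exact hx.2.ne' (hmem x hx.1 hx'.1)
  have hB : ∀ x ∈ B.erase v, degIn G (B ∪ C) x = degIn G B x := by
    intro x hx
    rw [Finset.mem_erase] at hx
    unfold degIn
    congr 1
    ext y
    simp only [Finset.mem_filter, Finset.mem_union]
    constructor
    · rintro ⟨hy | hy, h⟩
      · exact ⟨hy, h⟩
      · by_cases hyv : y = v
        · exact ⟨hyv ▸ hvB, h⟩
        · exact absurd h (hadj x hx.2 hx.1 y hy hyv)
    · exact fun h => ⟨.inl h.1, h.2⟩
  have hC : ∀ x ∈ C.erase v, degIn G (B ∪ C) x = degIn G C x := by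
    intro x hx
    rw [Finset.mem_erase] at hx
    unfold degIn
    congr 1
    ext y
    simp only [Finset.mem_filter, Finset.mem_union]
    constructor
    · rintro ⟨hy | hy, h⟩
      · by_cases hyv : y = v
        · exact ⟨hyv ▸ hvC, h⟩
        · exact absurd h.symm (hadj y hy hyv x hx.2 hx.1)
      · exact ⟨hy, h⟩
    · exact fun h => ⟨.inr h.1, h.2⟩
  refine ⟨hd, ?_⟩
  have hU : B ∪ C = insert v (B.erase v ∪ C.erase v) := by
    rw [← Finset.erase_union_distrib, Finset.insert_erase (Finset.mem_union_left _ hvB)]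
  have hdisj : Disjoint (B.erase v) (C.erase v) := by
    rw [Finset.disjoint_left]
    intro x hx hx'
    rw [Finset.mem_erase] at hx hx'
    exact hx.1 (hmem x hx.2 hx'.2)
  have hsum : degreePowerIn p G (B ∪ C) = (degIn G B v + degIn G C v) ^ p +
      (∑ x ∈ B.erase v, degIn G B x ^ p + ∑ x ∈ C.erase v, degIn G C x ^ p) := by
    have h1 : ∑ x ∈ B.erase v, degIn G (B ∪ C) x ^ p = ∑ x ∈ B.erase v, degIn G B x ^ p :=
      Finset.sum_congr rfl fun x hx => by rw [hB x hx]
    have h2 : ∑ x ∈ C.erase v, degIn G (B ∪ C) x ^ p = ∑ x ∈ C.erase v, degIn G C x ^ p :=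
      Finset.sum_congr rfl fun x hx => by rw [hC x hx]
    rw [degreePowerIn, ← Finset.add_sum_erase _ _ (Finset.mem_union_left C hvB), hd,
      Finset.erase_union_distrib, Finset.sum_union hdisj, h1, h2]
  rw [hsum, degreePowerIn, degreePowerIn, ← Finset.add_sum_erase _ _ hvB,
    ← Finset.add_sum_erase _ _ hvC]
  ring

end Separation

/-! ### The upper bound -/

theorem add_pow_add_pow_le (p b h c : ℕ) :
    (b + c) ^ p + (b + h) ^ p ≤ (b + h + c) ^ p + b ^ p := by
  induction p with
  | zero => simp
  | succ p ih =>
    have h1 : (b + c) ^ p ≤ (b + h + c) ^ p := Nat.pow_le_pow_left (by omega) _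
    have h2 : (b + h) ^ p ≤ (b + h + c) ^ p := Nat.pow_le_pow_left (by omega) _
    simp only [pow_succ]
    nlinarith [Nat.mul_le_mul_left b ih, Nat.mul_le_mul_left c h1, Nat.mul_le_mul_left h h2]

theorem add_pow_add_pow_lt {p b h c : ℕ} (hp : 1 < p) (hh : 0 < h) (hc : 0 < c) :
    (b + c) ^ p + (b + h) ^ p < (b + h + c) ^ p + b ^ p := by
  obtain ⟨p, rfl⟩ : ∃ q, p = q + 1 := ⟨p - 1, by omega⟩
  have ih := add_pow_add_pow_le p b h c
  have h1 : (b + c) ^ p < (b + h + c) ^ p := Nat.pow_lt_pow_left (by omega) (by omega)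
  have h2 : (b + h) ^ p ≤ (b + h + c) ^ p := Nat.pow_le_pow_left (by omega) _
  simp only [pow_succ]
  nlinarith [Nat.mul_le_mul_left b ih, Nat.mul_lt_mul_of_pos_left h1 hc, Nat.mul_le_mul_left h h2]

/-- The gain `(b + c)^p - b^p - c^p` from gluing at a vertex is increasing in both degrees. -/
theorem glue_pow_le (p : ℕ) {b c N M : ℕ} (hb : b ≤ N) (hc : c ≤ M) :
    (b + c) ^ p + N ^ p + M ^ p ≤ (N + M) ^ p + b ^ p + c ^ p := by
  obtain ⟨h, rfl⟩ := Nat.exists_eq_add_of_le hb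
  obtain ⟨k, rfl⟩ := Nat.exists_eq_add_of_le hc
  have h1 := add_pow_add_pow_le p b h c
  have h2 := add_pow_add_pow_le p c k (b + h)
  rw [show c + k + (b + h) = b + h + (c + k) by ring, show c + (b + h) = b + h + c by ring] at h2
  omega

theorem glue_pow_lt {p : ℕ} (hp : 1 < p) {b c N M : ℕ} (hb : b ≤ N) (hc : c ≤ M) (hN : 0 < N)
    (hM : 0 < M) (hlt : b + c < N + M) :
    (b + c) ^ p + N ^ p + M ^ p < (N + M) ^ p + b ^ p + c ^ p := by
  obtain ⟨h, rfl⟩ := Nat.exists_eq_add_of_le hb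
  obtain ⟨k, rfl⟩ := Nat.exists_eq_add_of_le hc
  have h1 := add_pow_add_pow_le p b h c
  have h2 := add_pow_add_pow_le p c k (b + h)
  have h3 : c + k + (b + h) = b + h + (c + k) := by ring
  have h4 : c + (b + h) = b + h + c := by ring
  rcases Nat.eq_zero_or_pos k with rfl | hk
  · have := add_pow_add_pow_lt (b := b) (h := h) (c := c) hp (by omega) (by omega)
    rw [h3, h4] at h2
    omega
  · have := add_pow_add_pow_lt (b := c) (h := k) (c := b + h) hp hk hN
    rw [h3, h4] at this
    omega

/-- The degree power of the friendship graph on `N + 1` vertices: the centre has degree `N`, the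
`2 * (N / 2)` matched leaves have degree `2`, and `N % 2` leaves are unmatched. -/
def friendshipValue (p N : ℕ) : ℕ := N ^ p + (N % 2 + N / 2 * (2 * 2 ^ p))

theorem friendshipValue_glue (p N M : ℕ) :
    friendshipValue p N + friendshipValue p M + (N + M) ^ p ≤
      friendshipValue p (N + M) + N ^ p + M ^ p := by
  have h : N % 2 + N / 2 * (2 * 2 ^ p) + (M % 2 + M / 2 * (2 * 2 ^ p)) ≤
      (N + M) % 2 + (N + M) / 2 * (2 * 2 ^ p) := by
    have hp : 1 ≤ 2 ^ p := Nat.one_le_two_pow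
    rcases Nat.lt_or_ge (N % 2 + M % 2) 2 with h | h
    · have h1 : (N + M) / 2 = N / 2 + M / 2 := by omega
      have h2 : (N + M) % 2 = N % 2 + M % 2 := by omega
      rw [h1, h2]
      exact le_of_eq (by ring)
    · have h1 : (N + M) / 2 = N / 2 + M / 2 + 1 := by omega
      have h2 : (N + M) % 2 = 0 := by omega
      have h3 : N % 2 = 1 := by omega
      have h4 : M % 2 = 1 := by omega
      rw [h1, h2, h3, h4]
      nlinarith
  unfold friendshipValue
  omega

theorem mul_two_pow_lt_friendshipValue {p N : ℕ} (hp : 1 < p) (hN : 3 ≤ N) :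
    (N + 1) * 2 ^ p < friendshipValue p N := by
  have h3 : 2 * 2 ^ p < 3 ^ p + 1 := by
    induction p, hp using Nat.le_induction with
    | base => norm_num
    | succ p hp ih => rw [pow_succ, pow_succ]; omega
  have h4 : 3 ^ p ≤ N ^ p := Nat.pow_le_pow_left hN _
  have h5 : 2 ^ p < 3 ^ p := Nat.pow_lt_pow_left (by norm_num) (by omega)
  unfold friendshipValue
  rcases Nat.mod_two_eq_zero_or_one N with h | h
  · have : (N + 1) * 2 ^ p = N / 2 * (2 * 2 ^ p) + 2 ^ p := by
      conv_lhs => rw [show N = N / 2 * 2 by omega]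
      ring
    omega
  · have : (N + 1) * 2 ^ p = N / 2 * (2 * 2 ^ p) + 2 * 2 ^ p := by
      conv_lhs => rw [show N = N / 2 * 2 + 1 by omega]
      ring
    omega

theorem friendshipValue_of_le_two {p N : ℕ} (hp : 1 < p) (hN : N ≤ 2) :
    friendshipValue p N = (N + 1) * N ^ p := by
  unfold friendshipValue
  interval_cases N
  · simp [show p ≠ 0 by omega]
  · simp
  · simp; ring

section Bound

variable {V : Type*} {G : SimpleGraph V}

/-- Equality forces a vertex adjacent to all others. No induction is needed for that: in the
gluing step it is the glued vertex, by strict convexity. -/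
theorem degreePowerIn_le {p : ℕ} (hp : 1 < p) (hG : FamilyFree evenCycles G) (N : ℕ) :
    ∀ A : Finset V, A.card = N + 1 → degreePowerIn p G A ≤ friendshipValue p N ∧
      (degreePowerIn p G A = friendshipValue p N → ∃ c ∈ A, degIn G A c = N) := by
  classical
  induction N using Nat.strong_induction_on with
  | _ N ih =>
  intro A hA
  have hle : ∀ x ∈ A, degIn G A x ≤ N := fun x hx => by
    have := degIn_le (G := G) hx
    omega
  rcases Nat.lt_or_ge N 3 with hN | hN
  · rw [friendshipValue_of_le_two hp (by omega)]
    have hsum : (N + 1) * N ^ p = ∑ x ∈ A, N ^ p := by simp [hA]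
    rw [hsum, degreePowerIn]
    refine ⟨Finset.sum_le_sum fun x hx => Nat.pow_le_pow_left (hle x hx) p, fun h => ?_⟩
    obtain ⟨c, hc⟩ : A.Nonempty := Finset.card_pos.1 (by omega)
    have := (Finset.sum_eq_sum_iff_of_le
      fun x hx => Nat.pow_le_pow_left (hle x hx) p).1 h c hc
    exact ⟨c, hc, Nat.pow_left_injective (by omega) this⟩
  by_cases h3 : ∃ v ∈ A, 3 ≤ degIn G A v
  · obtain ⟨v, hv, h3⟩ := h3
    obtain ⟨B, C, hU, hI, hB2, hC2, hadj⟩ := exists_separation hG hv h3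
    have hcard := Finset.card_union_add_card_inter B C
    rw [hU, hI, hA, Finset.card_singleton] at hcard
    have hvBC : v ∈ B ∩ C := by simp [hI]
    obtain ⟨hvB, hvC⟩ := Finset.mem_inter.1 hvBC
    obtain ⟨hd, hE⟩ := degreePowerIn_union p hI hadj
    rw [hU] at hd hE
    obtain ⟨n, hn⟩ : ∃ n, B.card = n + 1 := ⟨B.card - 1, by omega⟩
    obtain ⟨m, hm⟩ : ∃ m, C.card = m + 1 := ⟨C.card - 1, by omega⟩
    obtain rfl : N = n + m := by omega
    have hBle := (ih n (by omega) B hn).1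
    have hCle := (ih m (by omega) C hm).1
    have hdB : degIn G B v ≤ n := by
      have := degIn_le (G := G) hvB
      omega
    have hdC : degIn G C v ≤ m := by
      have := degIn_le (G := G) hvC
      omega
    have hglue := glue_pow_le p hdB hdC
    have hval := friendshipValue_glue p n m
    refine ⟨by omega, fun heq => ⟨v, hv, ?_⟩⟩
    by_contra hne
    have := glue_pow_lt hp hdB hdC (by omega) (by omega) (by omega)
    omega
  · push Not at h3
    have hlt : degreePowerIn p G A < friendshipValue p N := by
      refine lt_of_le_of_lt ?_ (mul_two_pow_lt_friendshipValue hp hN)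
      rw [← hA, ← smul_eq_mul]
      refine Finset.sum_le_card_nsmul _ _ _ fun x hx => Nat.pow_le_pow_left ?_ p
      have := h3 x hx
      omega
    exact ⟨hlt.le, fun h => absurd h hlt.ne⟩

end Bound

/-! ### Windmills -/

section Windmill

/-- `G` is the star with centre `c` together with a matching on the leaves. The matching is encoded
by the involution `σ` that exchanges matched leaves and fixes the centre and the unmatched
leaves. -/
structure IsWindmill {V : Type*} (G : SimpleGraph V) (c : V) (σ : Equiv.Perm V) : Prop where
  sq : σ ^ 2 = 1
  map_center : σ c = c
  adj_iff : ∀ x y, G.Adj x y ↔ x ≠ y ∧ (x = c ∨ y = c ∨ σ x = y)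

theorem exists_isWindmill {V : Type*} {G : SimpleGraph V} {c : V} (hc : ∀ x, x ≠ c → G.Adj c x)
    (hm : ∀ x y z, x ≠ c → y ≠ c → z ≠ c → G.Adj x y → G.Adj x z → y = z) :
    ∃ σ, IsWindmill G c σ := by
  classical
  let P : V → V → Prop := fun x y => x ≠ c ∧ y ≠ c ∧ G.Adj x y
  let f : V → V := fun x => if h : ∃ y, P x y then h.choose else x
  have hf : ∀ x y, P x y → f x = y := fun x y h => by
    have hex : ∃ y, P x y := ⟨y, h⟩
    have hs := hex.choose_spec
    have : f x = hex.choose := dif_pos hex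
    rw [this]
    exact hm x _ _ h.1 hs.2.1 h.2.1 hs.2.2 h.2.2
  have hf' : ∀ x, (¬ ∃ y, P x y) → f x = x := fun x h => dif_neg h
  have hinv : Function.Involutive f := fun x => by
    by_cases h : ∃ y, P x y
    · obtain ⟨y, h⟩ := h
      rw [hf x y h, hf y x ⟨h.2.1, h.1, h.2.2.symm⟩]
    · rw [hf' x h, hf' x h]
  refine ⟨hinv.toPerm f, ?_, ?_, fun x y => ⟨fun h => ⟨h.ne, ?_⟩, ?_⟩⟩
  · ext x
    simp [pow_two, hinv x]
  · exact hf' c fun ⟨y, h⟩ => h.1 rfl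
  · by_cases hx : x = c
    · exact .inl hx
    by_cases hy : y = c
    · exact .inr (.inl hy)
    exact .inr (.inr (hf x y ⟨hx, hy, h⟩))
  · rintro ⟨hne, rfl | rfl | h⟩
    · exact hc y hne.symm
    · exact (hc x hne).symm
    · change f x = y at h
      by_cases hex : ∃ y, P x y
      · obtain ⟨z, hz⟩ := hex
        rw [hf x z hz] at h
        exact h ▸ hz.2.2
      · exact absurd ((hf' x hex).symm.trans h) hne

/-- A path on three vertices avoiding `c` would close up to a `C_4` through `c`. -/
theorem exists_isWindmill_of_universal {V : Type*} {G : SimpleGraph V} {c : V}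
    (hG : FamilyFree evenCycles G) (hc : ∀ x, x ≠ c → G.Adj c x) : ∃ σ, IsWindmill G c σ := by
  refine exists_isWindmill hc fun x y z hx hy hz hxy hxz => ?_
  by_contra hyz
  refine not_even_length_of_isCycle hG
    (c := .cons (hc y hy) (.cons hxy.symm (.cons hxz (.cons (hc z hz).symm .nil)))) ?_ ?_
  · simp [Walk.cons_isCycle_iff, hxy.ne', hxz.ne, hy, hx, hyz, hz, Ne.symm hx, Ne.symm hy,
      Ne.symm hz]
  · exact ⟨2, rfl⟩

namespace IsWindmill

variable {V : Type*} {G : SimpleGraph V} {c : V} {σ : Equiv.Perm V}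

theorem apply_apply (h : IsWindmill G c σ) (x : V) : σ (σ x) = x := by
  simpa [pow_two] using congrArg (fun τ => τ x) h.sq

theorem degree_center [Fintype V] [DecidableRel G.Adj] (h : IsWindmill G c σ) :
    G.degree c = Fintype.card V - 1 := by
  classical
  rw [← card_neighborFinset_eq_degree, ← Finset.card_univ,
    ← Finset.card_erase_of_mem (Finset.mem_univ c)]
  congr 1
  ext x
  simp [h.adj_iff, eq_comm]

theorem degree_of_apply_eq [Fintype V] [DecidableRel G.Adj] (h : IsWindmill G c σ) {x : V}
    (hx : x ≠ c) (hσ : σ x = x) : G.degree x = 1 := by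
  classical
  rw [← card_neighborFinset_eq_degree, Finset.card_eq_one]
  refine ⟨c, ?_⟩
  ext y
  simp only [mem_neighborFinset, h.adj_iff, hσ, Finset.mem_singleton]
  grind

theorem degree_of_apply_ne [Fintype V] [DecidableRel G.Adj] (h : IsWindmill G c σ) {x : V}
    (hσ : σ x ≠ x) : G.degree x = 2 := by
  classical
  have hx : x ≠ c := fun hx => hσ (hx ▸ h.map_center)
  have hσc : c ≠ σ x := fun hc => hx (σ.injective (hc.symm.trans h.map_center.symm))
  rw [← card_neighborFinset_eq_degree, ← Finset.card_pair hσc]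
  congr 1
  ext y
  simp only [mem_neighborFinset, h.adj_iff, Finset.mem_insert, Finset.mem_singleton]
  grind

theorem support_subset [Fintype V] [DecidableEq V] (h : IsWindmill G c σ) :
    σ.support ⊆ Finset.univ.erase c := fun x hx => by
  rw [Equiv.Perm.mem_support] at hx
  exact Finset.mem_erase.2 ⟨fun hxc => hx (hxc ▸ h.map_center), Finset.mem_univ x⟩

theorem degreePower_eq [Fintype V] [DecidableEq V] [DecidableRel G.Adj] (h : IsWindmill G c σ)
    (p : ℕ) {N : ℕ} (hN : Fintype.card V = N + 1) :
    σ.support.card ≤ N ∧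
      degreePower p G = N ^ p + ((N - σ.support.card) + σ.support.card * 2 ^ p) := by
  have hcard : (Finset.univ.erase c).card = N := by
    rw [Finset.card_erase_of_mem (Finset.mem_univ c), Finset.card_univ, hN, Nat.add_sub_cancel]
  refine ⟨hcard ▸ Finset.card_le_card h.support_subset, ?_⟩
  rw [degreePower, ← Finset.add_sum_erase _ _ (Finset.mem_univ c), h.degree_center, hN,
    ← Finset.sum_sdiff h.support_subset, Nat.add_sub_cancel]
  have h1 : ∀ x ∈ Finset.univ.erase c \ σ.support, G.degree x ^ p = 1 := fun x hx => by
    rw [Finset.mem_sdiff, Equiv.Perm.mem_support, not_not, Finset.mem_erase] at hx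
    rw [h.degree_of_apply_eq hx.1.1 hx.2, one_pow]
  have h2 : ∀ x ∈ σ.support, G.degree x ^ p = 2 ^ p := fun x hx => by
    rw [h.degree_of_apply_ne (Equiv.Perm.mem_support.1 hx)]
  rw [Finset.sum_congr rfl h1, Finset.sum_congr rfl h2, Finset.sum_const, Finset.sum_const,
    Finset.card_sdiff_of_subset h.support_subset, hcard]
  simp

/-- A windmill attains the friendship value exactly when its matching is maximum. -/
theorem degreePower_eq_iff [Fintype V] [DecidableEq V] [DecidableRel G.Adj]
    (h : IsWindmill G c σ) {p N : ℕ} (hp : 1 < p) (hN : Fintype.card V = N + 1) :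
    degreePower p G = friendshipValue p N ↔ σ.support.card = 2 * (N / 2) := by
  obtain ⟨hs, he⟩ := h.degreePower_eq p hN
  obtain ⟨k, hk⟩ := Equiv.Perm.two_dvd_card_support h.sq
  rw [he, friendshipValue, hk]
  rw [hk] at hs
  constructor
  · intro heq
    obtain ⟨d, hd⟩ : ∃ d, N / 2 = k + d := ⟨N / 2 - k, by omega⟩
    have h2 : 2 < 2 ^ p := by
      calc 2 < 2 ^ 2 := by norm_num
        _ ≤ 2 ^ p := Nat.pow_le_pow_right (by norm_num) hp
    have h3 : N - 2 * k = 2 * d + N % 2 := by omega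
    rw [h3, hd] at heq
    have h4 : d * (2 ^ p) = d := by nlinarith
    rcases Nat.eq_zero_or_pos d with rfl | hd0
    · omega
    · nlinarith
  · intro hk'
    have h1 : N / 2 = k := by omega
    have h2 : N - 2 * k = N % 2 := by omega
    rw [h2, h1]
    ring

theorem cycleGraph_free (h : IsWindmill G c σ) {m : ℕ} (hm : 4 ≤ m) :
    (cycleGraph m).Free G := by
  obtain ⟨k, rfl⟩ := Nat.exists_eq_add_of_le' hm
  rintro ⟨φ⟩
  have hadj : ∀ i : Fin (k + 4), G.Adj (φ i) (φ (i + 1)) := fun i =>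
    φ.toHom.map_adj ((cycleGraph_adj (n := k + 2)).2 (.inr (add_sub_cancel_left i 1)))
  have h2 : (1 + 1 : Fin (k + 4)) ≠ 0 := by
    intro h0
    have := congrArg Fin.val h0
    simp only [Fin.val_add, Fin.val_one, Fin.val_zero, Nat.reduceAdd] at this
    rw [Nat.mod_eq_of_lt (by omega)] at this
    omega
  have h3 : (1 + (1 + 1) : Fin (k + 4)) ≠ 0 := by
    intro h0
    have := congrArg Fin.val h0
    simp only [Fin.val_add, Fin.val_one, Fin.val_zero, Nat.add_mod_mod, Nat.reduceAdd] at this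
    rw [Nat.mod_eq_of_lt (by omega)] at this
    omega
  have hne2 : ∀ i : Fin (k + 4), i + 1 + 1 ≠ i := fun i hi => h2 (by
    rwa [add_assoc, add_eq_left] at hi)
  have hne3 : ∀ i : Fin (k + 4), i + 1 + 1 + 1 ≠ i := fun i hi => h3 (by
    rwa [add_assoc, add_assoc, add_eq_left] at hi)
  -- The two neighbours of a leaf on the cycle are distinct, so the centre is one of them.
  have hcen : ∀ i : Fin (k + 4), φ i = c ∨ φ (i + 1) = c ∨ φ (i + 1 + 1) = c := by
    intro i
    by_contra! hcon
    have a1 := (h.adj_iff _ _).1 (hadj (i + 1))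
    have a2 := (h.adj_iff _ _).1 (hadj i).symm
    refine hne2 i (φ.injective ?_)
    simp only [hcon, false_or] at a1 a2
    exact a1.2.symm.trans a2.2
  obtain ⟨i, hi⟩ : ∃ i, φ i = c := by
    rcases hcen 0 with h | h | h <;> exact ⟨_, h⟩
  rcases hcen (i + 1) with h' | h' | h'
  · exact (hadj i).ne (hi.trans h'.symm)
  · exact hne2 i (φ.injective (h'.trans hi.symm))
  · exact hne3 i (φ.injective (h'.trans hi.symm))

theorem familyFree (h : IsWindmill G c σ) : FamilyFree evenCycles G := by
  rintro _ ⟨k, hk, rfl⟩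
  exact h.cycleGraph_free (by omega)

end IsWindmill

/-- Involutions moving equally many points are conjugate; as both fix a base point, the
conjugating bijection can be corrected by a transposition so as to match the base points. -/
theorem exists_equiv_of_involutions {V W : Type*} [Fintype V] [Fintype W] [DecidableEq V]
    [DecidableEq W] {σ : Equiv.Perm V} {τ : Equiv.Perm W} {c : V} {d : W} (hσ : σ ^ 2 = 1)
    (hτ : τ ^ 2 = 1) (hc : σ c = c) (hd : τ d = d) (hVW : Fintype.card V = Fintype.card W)
    (hs : σ.support.card = τ.support.card) :
    ∃ π : V ≃ W, π c = d ∧ ∀ x, π (σ x) = τ (π x) := by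
  let e : V ≃ W := Fintype.equivOfCardEq hVW
  let σ' : Equiv.Perm W := e.permCongr σ
  have hσ' : σ' ^ 2 = 1 := by
    ext x
    have := congrArg (fun τ => τ (e.symm x)) hσ
    simp only [pow_two, Equiv.Perm.mul_apply, Equiv.Perm.one_apply] at this
    simp [σ', pow_two, this]
  have hs' : σ'.support.card = τ.support.card := by
    rw [← hs]
    symm
    refine Finset.card_bij (fun x _ => e x) ?_ (fun x _ y _ h => e.injective h) ?_
    · intro x hx
      simpa [σ'] using hx
    · intro y hy
      refine ⟨e.symm y, ?_, by simp⟩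
      rw [Equiv.Perm.mem_support] at hy ⊢
      intro h
      exact hy (by simp [σ', h])
  have hct : σ'.cycleType = τ.cycleType := by
    have h1 := Equiv.Perm.cycleType_of_pow_prime_eq_one hσ'
    have h2 := Equiv.Perm.cycleType_of_pow_prime_eq_one hτ
    rw [← Equiv.Perm.sum_cycleType, ← Equiv.Perm.sum_cycleType, h1, h2, Multiset.sum_replicate,
      Multiset.sum_replicate, smul_eq_mul, smul_eq_mul] at hs'
    rw [h1, h2, Nat.eq_of_mul_eq_mul_right two_pos hs']
  obtain ⟨ρ, hρ⟩ := isConj_iff.1 (Equiv.Perm.isConj_of_cycleType_eq hct)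
  let π₀ : V ≃ W := e.trans ρ
  have h0 : ∀ x, π₀ (σ x) = τ (π₀ x) := fun x => by
    rw [← hρ]
    simp [π₀, σ']
  refine ⟨π₀.trans (Equiv.swap (π₀ c) d), by simp, fun x => ?_⟩
  have h1 : τ (π₀ c) = π₀ c := by rw [← h0, hc]
  have hinj := τ.injective
  simp only [Equiv.trans_apply, h0]
  by_cases hx1 : π₀ x = π₀ c
  · rw [hx1, h1, Equiv.swap_apply_left, hd]
  by_cases hx2 : π₀ x = d
  · rw [hx2, hd, Equiv.swap_apply_right, h1]
  rw [Equiv.swap_apply_of_ne_of_ne hx1 hx2, Equiv.swap_apply_of_ne_of_ne]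
  · exact fun h => hx1 (hinj (h.trans h1.symm))
  · exact fun h => hx2 (hinj (h.trans hd.symm))

theorem IsWindmill.nonempty_iso {V W : Type*} [Fintype V] [Fintype W] [DecidableEq V]
    [DecidableEq W] {G : SimpleGraph V} {H : SimpleGraph W} {σ : Equiv.Perm V}
    {τ : Equiv.Perm W} {c : V} {d : W} (hG : IsWindmill G c σ) (hH : IsWindmill H d τ)
    (hVW : Fintype.card V = Fintype.card W) (hs : σ.support.card = τ.support.card) :
    Nonempty (G ≃g H) := by
  obtain ⟨π, hπ, hcomm⟩ :=
    exists_equiv_of_involutions hG.sq hH.sq hG.map_center hH.map_center hVW hs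
  refine ⟨⟨π, fun {x y} => ?_⟩⟩
  rw [hG.adj_iff, hH.adj_iff, ← hcomm, ← hπ]
  simp only [ne_eq, π.injective.eq_iff]

end Windmill

/-! ### The friendship graph -/

theorem friendshipGraph_adj {n : ℕ} (i j : Fin n) : (friendshipGraph n).Adj i j ↔
    i ≠ j ∧ (i.val = 0 ∨ j.val = 0 ∨ (i.val + 1) / 2 = (j.val + 1) / 2) := by
  simp only [friendshipGraph, sup_adj, starOn, leafMatching]
  tauto

theorem exists_isWindmill_friendshipGraph (N : ℕ) :
    ∃ σ, IsWindmill (friendshipGraph (N + 1)) 0 σ ∧ σ.support.card = 2 * (N / 2) := by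
  obtain ⟨σ, hσ⟩ : ∃ σ, IsWindmill (friendshipGraph (N + 1)) 0 σ := by
    refine exists_isWindmill (fun x hx => ?_) fun x y z hx hy hz hxy hxz => ?_
    · rw [friendshipGraph_adj]
      exact ⟨hx.symm, .inl rfl⟩
    · rw [friendshipGraph_adj] at hxy hxz
      simp only [ne_eq, Fin.ext_iff, Fin.val_zero] at *
      omega
  refine ⟨σ, hσ, ?_⟩
  -- Every leaf other than the last vertex `N` is matched, which leaves at most one exception.
  have hsub : (Finset.univ.erase 0).erase (Fin.last N) ⊆ σ.support := by
    intro x hx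
    simp only [Finset.mem_erase, Finset.mem_univ, and_true, ne_eq, Fin.ext_iff, Fin.val_last,
      Fin.val_zero] at hx
    have hxN := x.isLt
    obtain ⟨y, hy, hxy, hdiv⟩ : ∃ y : Fin (N + 1), y.val ≠ 0 ∧ x.val ≠ y.val ∧
        (x.val + 1) / 2 = (y.val + 1) / 2 := by
      rcases Nat.mod_two_eq_zero_or_one x.val with h | h
      · exact ⟨⟨x.val - 1, by omega⟩, by simp; omega, by simp; omega, by simp; omega⟩
      · exact ⟨⟨x.val + 1, by omega⟩, by simp, by simp, by simp; omega⟩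
    have hne : x ≠ y := fun h => hxy (congrArg Fin.val h)
    rcases ((hσ.adj_iff x y).1 ((friendshipGraph_adj x y).2 ⟨hne, .inr (.inr hdiv)⟩)).2 with
      h | h | h
    · exact absurd (congrArg Fin.val h) hx.2
    · exact absurd (congrArg Fin.val h) hy
    · rw [Equiv.Perm.mem_support, h]
      exact hne.symm
  have h1 := Finset.card_le_card hsub
  have h2 := Finset.pred_card_le_card_erase (s := (Finset.univ : Finset (Fin (N + 1))).erase 0)
    (a := Fin.last N)
  rw [Finset.card_erase_of_mem (Finset.mem_univ _), Finset.card_univ, Fintype.card_fin] at h2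
  have h3 := (hσ.degreePower_eq 0 (Fintype.card_fin (N + 1))).1
  obtain ⟨k, hk⟩ := Equiv.Perm.two_dvd_card_support hσ.sq
  omega

/-! ### The extremal number -/

theorem degreePowerIn_univ {V : Type*} [Fintype V] (p : ℕ) (G : SimpleGraph V)
    [DecidableRel G.Adj] : degreePowerIn p G Finset.univ = degreePower p G := by
  classical
  refine Finset.sum_congr rfl fun x _ => ?_
  rw [← card_neighborFinset_eq_degree, degIn]
  congr 2
  ext y
  simp

theorem degreePower_le_friendshipValue {V : Type*} [Fintype V] {G : SimpleGraph V}
    [DecidableRel G.Adj] (hG : FamilyFree evenCycles G) {p N : ℕ} (hp : 1 < p)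
    (hN : Fintype.card V = N + 1) : degreePower p G ≤ friendshipValue p N ∧
      (degreePower p G = friendshipValue p N → ∃ c σ, IsWindmill G c σ) := by
  classical
  obtain ⟨h1, h2⟩ := degreePowerIn_le hp hG N Finset.univ (by rw [Finset.card_univ, hN])
  rw [degreePowerIn_univ] at h1 h2
  refine ⟨h1, fun h => ?_⟩
  obtain ⟨c, -, hc⟩ := h2 h
  refine ⟨c, exists_isWindmill_of_universal hG fun x hx => ?_⟩
  have hsub : Finset.univ.filter (G.Adj c) ⊆ Finset.univ.erase c := fun y hy =>
    Finset.mem_erase.2 ⟨(Finset.mem_filter.1 hy).2.ne', Finset.mem_univ y⟩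
  have heq := Finset.eq_of_subset_of_card_le hsub (by
    rw [Finset.card_erase_of_mem (Finset.mem_univ c), Finset.card_univ, hN, Nat.add_sub_cancel]
    rw [← hc, degIn]
    exact le_of_eq (by congr))
  have : x ∈ Finset.univ.filter (G.Adj c) := heq ▸ Finset.mem_erase.2 ⟨hx, Finset.mem_univ x⟩
  exact (Finset.mem_filter.1 this).2

theorem degreePower_congr {V W : Type*} [Fintype V] [Fintype W] {G : SimpleGraph V}
    {H : SimpleGraph W} [DecidableRel G.Adj] [DecidableRel H.Adj] (e : G ≃g H) (p : ℕ) :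
    degreePower p G = degreePower p H :=
  Fintype.sum_equiv e.toEquiv _ _ fun x => by
    rw [← e.degree_eq x]
    rfl

theorem corollary1 (n p : ℕ) (hn : 4 ≤ n) (hp : 1 < p) :
    exDegreePower p n evenCycles = degreePower p (friendshipGraph n) ∧
    ∀ {V : Type*} [Fintype V] (G : SimpleGraph V) [DecidableRel G.Adj],
      Fintype.card V = n →
        ((FamilyFree evenCycles G ∧ degreePower p G = exDegreePower p n evenCycles) ↔
          Nonempty (G ≃g friendshipGraph n)) := by
  classical
  obtain ⟨N, rfl⟩ : ∃ N, n = N + 1 := ⟨n - 1, by omega⟩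
  obtain ⟨τ, hτ, hs⟩ := exists_isWindmill_friendshipGraph N
  have hF : degreePower p (friendshipGraph (N + 1)) = friendshipValue p N :=
    (hτ.degreePower_eq_iff hp (Fintype.card_fin _)).2 hs
  have hex : exDegreePower p (N + 1) evenCycles = friendshipValue p N := by
    refine le_antisymm (Finset.sup_le fun G hG => ?_) ?_
    · exact (degreePower_le_friendshipValue (Finset.mem_filter.1 hG).2 hp
        (Fintype.card_fin _)).1
    · have hmem : friendshipGraph (N + 1) ∈
          Finset.univ.filter fun G : SimpleGraph (Fin (N + 1)) => FamilyFree evenCycles G :=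
        Finset.mem_filter.2 ⟨Finset.mem_univ _, hτ.familyFree⟩
      rw [← hF, exDegreePower]
      convert Finset.le_sup (f := fun G : SimpleGraph (Fin (N + 1)) => degreePower p G) hmem
  refine ⟨hex.trans hF.symm, fun {V} _ G _ hV => ?_⟩
  rw [hex]
  constructor
  · rintro ⟨hG, heq⟩
    obtain ⟨c, σ, hσ⟩ := (degreePower_le_friendshipValue hG hp hV).2 heq
    exact hσ.nonempty_iso hτ (by rw [hV, Fintype.card_fin])
      (((hσ.degreePower_eq_iff hp hV).1 heq).trans hs.symm)
  · rintro ⟨e⟩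
    refine ⟨fun H hH => (free_congr_right e).2 (hτ.familyFree H hH), ?_⟩
    rw [degreePower_congr e, hF]
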